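/- Let $d\ge 2$. For a function $F:\mathbb{R}^d\to\mathbb{R}$ one observes $(X_1,Y_1),\dots,(X_n,Y_n)$ with $Y_i=F(X_i)+\varepsilon_i$, where the noise variables $\varepsilon_i$ are i.i.d., centered, with Lebesgue density $p$ on $\mathbb{R}$, the design points $X_i$ are i.i.d. with Lebesgue density $g$ on $\mathbb{R}^d$, and the two sequences are independent. Let $\mathbb{E}^{(n)}_F$ be the expectation under the law of this sample. Assume: (noise) there exist $\mathfrak{q},\mathfrak{Q}>0$ such that for all $v_1,v_2\in[-\mathfrak{q},\mathfrak{q}]$ $$\int_{\mathbb{R}}\frac{p(y+v_1)\,p(y+v_2)}{p(y)}\,dy\le 1+\mathfrak{Q}\,|v_1v_2| ,$$ where the integrand is $[0,\infty]$-valued with $a/0=\infty$ for $a>0$ and $0/0=0$; (design) there exist $\mathfrak{g}>0$ and $\varpi>1$ such that $g(x)\le \mathfrak{g}\,(1+|x|_2^{\varpi})^{-1}$ for all $x\in\mathbb{R}^d$. For $\beta,L>0$ let $m_\beta$ be the largest integer strictly less than $\beta$, let $\mathbb{H}(\beta,L)$ be the set of $m_\beta$-times continuously differentiable functions $f:\mathbb{R}\to\mathbb{R}$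 with $\|f^{(m)}\|_\infty\le L$ for all $0\le m\le m_\beta$ and $|f^{(m_\beta)}(u+h)-f^{(m_\beta)}(u)|\le L h^{\beta-m_\beta}$ for all $u\in\mathbb{R}$, $h>0$, and let $$\mathbb{F}_d(\beta,L)=\{F:\mathbb{R}^d\to\mathbb{R}\;:\;F(z)=f(z^{\top}\theta),\ f\in\mathbb{H}(\beta,L),\ \theta\in\mathbb{S}^{d-1}\}.$$ Then for every $t\in[-1/2,1/2]^d$, $r\ge1$, $\beta>0$, $L>0$ and all sufficiently large $n\in\mathbb{N}$, $$\inf_{\widetilde F}\ \sup_{F\in\mathbb{F}_d(\beta,L)}\bigl(\mathbb{E}^{(n)}_F|\widetilde F(t)-F(t)|^r\bigr)^{1/r}\ \ge\ \varkappa_2\,L^{1/(2\beta+1)}\Bigl(\frac{\ln n}{n}\Bigr)^{\beta/(2\beta+1)},$$ where the infimum is over all estimators, i.e. all functions $\widetilde F(\cdot)$ depending measurably on $(X_1,Y_1),\dots,(X_n,Y_n)$. Here $\varkappa_2>0$ is a constant that depends only on $d$, $\beta$, $\mathfrak{q}$, $\mathfrak{Q}$, $\mathfrak{g}$ and $\varpi$;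 in particular it does not depend on $n$ or $L$. -/

import Mathlib

open MeasureTheory
open scoped ENNReal

namespace SingleIndex

/-- `ρ` is a probability density with respect to the reference (Lebesgue) measure. -/
structure IsProbDensity {E : Type*} [MeasureSpace E] (ρ : E → ℝ) : Prop where
  measurable : Measurable ρ
  nonneg : ∀ x, 0 ≤ ρ x
  lintegral_eq_one : ∫⁻ x, ENNReal.ofReal (ρ x) = 1

/-- The noise density has a finite first moment and mean zero. -/
def IsCentered (p : ℝ → ℝ) : Prop :=
  Integrable (fun y => y * p y) ∧ ∫ y, y * p y = 0

/-- Noise-density condition: for all `v₁, v₂ ∈ [-q, q]`,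
`∫ p (y + v₁) p (y + v₂) / p y dy ≤ 1 + Q |v₁ v₂|`.
The integrand is `[0, ∞]`-valued with the usual conventions `a / 0 = ∞` for `a > 0` and
`0 / 0 = 0`, so that the shifts of `p` are forced to be absolutely continuous with respect
to `p`. -/
def NoiseCondition (q Q : ℝ) (p : ℝ → ℝ) : Prop :=
  ∀ v₁ ∈ Set.Icc (-q) q, ∀ v₂ ∈ Set.Icc (-q) q,
    ∫⁻ y, ENNReal.ofReal (p (y + v₁)) * ENNReal.ofReal (p (y + v₂)) / ENNReal.ofReal (p y)
      ≤ ENNReal.ofReal (1 + Q * |v₁ * v₂|)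

/-- Design-tail condition: `g x ≤ G / (1 + |x|₂ ^ ϖ)` for all `x`. -/
def DesignCondition {d : ℕ} (G ϖ : ℝ) (g : EuclideanSpace ℝ (Fin d) → ℝ) : Prop :=
  ∀ x, g x ≤ (1 + ‖x‖ ^ ϖ)⁻¹ * G

/-- The maximal integer strictly less than `β` (for `β > 0`). -/
noncomputable def holderOrder (β : ℝ) : ℕ := ⌈β⌉₊ - 1

/-- The Hölder class `ℍ(β, L)` on the real line. -/
def holderClass (β L : ℝ) : Set (ℝ → ℝ) :=
  {f | ContDiff ℝ (holderOrder β) f ∧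
    (∀ m ≤ holderOrder β, ∀ u, |iteratedDeriv m f u| ≤ L) ∧
    ∀ u h : ℝ, 0 < h →
      |iteratedDeriv (holderOrder β) f (u + h) - iteratedDeriv (holderOrder β) f u|
        ≤ L * h ^ (β - holderOrder β)}

/-- The single-index class `𝔽_d(β, L)`: functions `z ↦ f (zᵀ θ)` with `f ∈ ℍ(β, L)` and `θ` a
Euclidean unit vector. -/
def singleIndexClass (d : ℕ) (β L : ℝ) : Set (EuclideanSpace ℝ (Fin d) → ℝ) :=
  {F | ∃ f ∈ holderClass β L, ∃ θ : EuclideanSpace ℝ (Fin d), ‖θ‖ = 1 ∧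
    ∀ z, F z = f (inner ℝ z θ)}

/-- The law of one observation `(X, F X + ε)`, where `X` and `ε` are independent with Lebesgue
densities `g` and `p`. -/
noncomputable def obsLaw {d : ℕ} (g : EuclideanSpace ℝ (Fin d) → ℝ) (p : ℝ → ℝ)
    (F : EuclideanSpace ℝ (Fin d) → ℝ) : Measure (EuclideanSpace ℝ (Fin d) × ℝ) :=
  (((volume : Measure (EuclideanSpace ℝ (Fin d))).withDensity
      fun x => ENNReal.ofReal (g x)).prod
    ((volume : Measure ℝ).withDensity fun y => ENNReal.ofReal (p y))).map
      fun z => (z.1, F z.1 + z.2)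

/-- The joint law of the `n` independent observations `(X₁, Y₁), …, (Xₙ, Yₙ)`. -/
noncomputable def sampleLaw {d : ℕ} (n : ℕ) (g : EuclideanSpace ℝ (Fin d) → ℝ) (p : ℝ → ℝ)
    (F : EuclideanSpace ℝ (Fin d) → ℝ) : Measure (Fin n → EuclideanSpace ℝ (Fin d) × ℝ) :=
  Measure.pi fun _ => obsLaw g p F

/-- An estimator is a function on `ℝᵈ` depending measurably on the sample. -/
def IsEstimator {d n : ℕ}
    (Fhat : (Fin n → EuclideanSpace ℝ (Fin d) × ℝ) → EuclideanSpace ℝ (Fin d) → ℝ) : Prop :=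
  ∀ x, Measurable fun data => Fhat data x

/-- The pointwise risk `(𝔼_F |F̂(t) - F(t)|^r)^{1/r}`, with values in `[0, ∞]`. -/
noncomputable def pointwiseRisk {d n : ℕ} (g : EuclideanSpace ℝ (Fin d) → ℝ) (p : ℝ → ℝ) (r : ℝ)
    (t : EuclideanSpace ℝ (Fin d))
    (Fhat : (Fin n → EuclideanSpace ℝ (Fin d) × ℝ) → EuclideanSpace ℝ (Fin d) → ℝ)
    (F : EuclideanSpace ℝ (Fin d) → ℝ) : ℝ≥0∞ :=
  (∫⁻ data, ENNReal.ofReal (|Fhat data t - F t|) ^ r ∂(sampleLaw n g p F)) ^ (1 / r)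

/-- The minimax pointwise risk at `t` over a class `S`: the infimum over all estimators of the
supremum over `S` of the pointwise risk. -/
noncomputable def minimaxRisk {d : ℕ} (n : ℕ) (g : EuclideanSpace ℝ (Fin d) → ℝ) (p : ℝ → ℝ)
    (r : ℝ) (t : EuclideanSpace ℝ (Fin d)) (S : Set (EuclideanSpace ℝ (Fin d) → ℝ)) : ℝ≥0∞ :=
  ⨅ (Fhat : (Fin n → EuclideanSpace ℝ (Fin d) × ℝ) → EuclideanSpace ℝ (Fin d) → ℝ)
    (_ : IsEstimator Fhat), ⨆ F ∈ S, pointwiseRisk g p r t Fhat F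

/-- The rate `ψ_n(β, L) = L^{1/(2β+1)} (n⁻¹ ln n)^{β/(2β+1)}`. -/
noncomputable def rate (n : ℕ) (β L : ℝ) : ℝ :=
  L ^ (1 / (2 * β + 1)) * ((n : ℝ)⁻¹ * Real.log n) ^ (β / (2 * β + 1))

end SingleIndex

/-! The null function is tested against bumps `A * φ(h⁻¹ ⟨x - t, θ⟩)` of common height `A ≍ L h^β`
at `t`, with the direction `θ` random. An estimator with error below `A / 2` at `t` would separate
the two hypotheses, so it suffices to bound the second moment of the mixture likelihood ratio under
the null (`mixture_test_lower_bound`, `le_minimaxRisk`).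

Each bump lives on a slab of half-width `h` through `t`. By the noise condition, two directions
contribute at most `(1 + Q A² P(S ∩ S'))^n`, where `P` is the design law. A single slab has mass of
order `h`, but two independent random slabs overlap in mean mass only `O(h^(3/2))`
(`exists_localized_prior`). Hence `n A² h` may grow like a small multiple of `log n`: the resulting
factor `n^γ log n` is beaten by the extra `h^(1/2)`. Solving `n (L h^β)² h ≍ log n` gives the rate,
and not knowing the direction is what produces the logarithm. -/

namespace SingleIndex

/-! ### Product densities, mixtures and testing. -/

theorem lintegral_pi_prod {ι α : Type*} [Fintype ι] [MeasurableSpace α] (μ : Measure α)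
    [IsProbabilityMeasure μ] {f : ι → α → ℝ≥0∞} (hf : ∀ i, Measurable (f i)) :
    ∫⁻ x, ∏ i, f i (x i) ∂Measure.pi (fun _ : ι => μ) = ∏ i, ∫⁻ x, f i x ∂μ := by
  rw [ProbabilityTheory.lintegral_prod_eq_prod_lintegral_of_indepFun Finset.univ
    (fun i (x : ι → α) => f i (x i))
    (ProbabilityTheory.iIndepFun_pi (μ := fun _ : ι => μ) fun i => (hf i).aemeasurable)
    (fun i => (hf i).comp (measurable_pi_apply i))]
  exact Finset.prod_congr rfl fun i _ =>
    (measurePreserving_eval (fun _ : ι => μ) i).lintegral_comp (hf i)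

theorem pi_withDensity {ι α : Type*} [Fintype ι] [MeasurableSpace α] (μ : Measure α)
    [IsProbabilityMeasure μ] {ρ : α → ℝ≥0∞} (hρ : Measurable ρ) [SigmaFinite (μ.withDensity ρ)] :
    Measure.pi (fun _ : ι => μ.withDensity ρ)
      = (Measure.pi fun _ : ι => μ).withDensity fun x => ∏ i, ρ (x i) := by
  refine Measure.pi_eq fun s hs => ?_
  rw [withDensity_apply _ (MeasurableSet.univ_pi hs),
    ← lintegral_indicator (MeasurableSet.univ_pi hs)]
  have hprod : ∀ x : ι → α, (Set.univ.pi s).indicator (fun x => ∏ i, ρ (x i)) x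
      = ∏ i, (s i).indicator ρ (x i) := by
    intro x
    by_cases hx : x ∈ Set.univ.pi s
    · rw [Set.indicator_of_mem hx]
      exact Finset.prod_congr rfl fun i _ => (Set.indicator_of_mem (hx i trivial) _).symm
    · rw [Set.indicator_of_notMem hx]
      obtain ⟨i, hi⟩ : ∃ i, x i ∉ s i := by simpa using hx
      exact (Finset.prod_eq_zero (Finset.mem_univ i) (Set.indicator_of_notMem hi _)).symm
  simp_rw [hprod]
  rw [lintegral_pi_prod μ fun i => hρ.indicator (hs i)]
  exact Finset.prod_congr rfl fun i _ => by
    rw [lintegral_indicator (hs i), withDensity_apply _ (hs i)]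

/-- Tonelli. It serves twice: for mixtures of likelihood ratios, and for slab indicators, where it
turns the mean overlap of two slabs into an integral of a squared probability. -/
theorem lintegral_lintegral_mul_self {Ω W : Type*} [MeasurableSpace Ω] [MeasurableSpace W]
    (P : Measure Ω) [SFinite P] (ν : Measure W) [SFinite ν]
    {f : W → Ω → ℝ≥0∞} (hf : Measurable (Function.uncurry f)) :
    ∫⁻ w, ∫⁻ w', ∫⁻ x, f w x * f w' x ∂P ∂ν ∂ν
      = ∫⁻ x, (∫⁻ w, f w x ∂ν) * (∫⁻ w, f w x ∂ν) ∂P := by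
  have hfx : ∀ w, Measurable (f w) := fun w => hf.comp measurable_prodMk_left
  have hfw : ∀ x, Measurable fun w => f w x := fun x => hf.comp measurable_prodMk_right
  have hmix : Measurable fun x => ∫⁻ w, f w x ∂ν := hf.lintegral_prod_left'
  have h : ∀ w, ∫⁻ w', ∫⁻ x, f w x * f w' x ∂P ∂ν
      = ∫⁻ x, f w x * ∫⁻ w', f w' x ∂ν ∂P := by
    intro w
    rw [lintegral_lintegral_swap
      (f := fun w' x => f w x * f w' x) (((hfx w).comp measurable_snd).mul hf).aemeasurable]
    exact lintegral_congr fun x => lintegral_const_mul _ (hfw x)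
  simp_rw [h]
  rw [lintegral_lintegral_swap
    (f := fun w x => f w x * ∫⁻ w', f w' x ∂ν) (hf.mul (hmix.comp measurable_snd)).aemeasurable]
  exact lintegral_congr fun x => lintegral_mul_const _ (hfw x)

theorem indicator_le_sq_add {α : Type*} (D : Set α) (f : α → ℝ≥0∞) (x : α) :
    D.indicator f x ≤ 8⁻¹ * (f x * f x) + D.indicator (fun _ => 8) x := by
  by_cases hx : x ∈ D
  · simp only [Set.indicator_of_mem hx]
    rcases le_total (f x) 8 with h | h
    · exact h.trans le_add_self
    · refine le_trans ?_ le_self_add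
      calc f x = 8⁻¹ * (8 * f x) := by
            rw [← mul_assoc, ENNReal.inv_mul_cancel (by norm_num) (by norm_num), one_mul]
        _ ≤ 8⁻¹ * (f x * f x) := by gcongr
  · simp [Set.indicator_of_notMem hx]

/-- Testing a point null hypothesis against a mixture with bounded second moment of the
likelihood ratio. -/
theorem mixture_test_lower_bound {Ω W : Type*} [MeasurableSpace Ω] [MeasurableSpace W]
    (P₀ : Measure Ω) [IsProbabilityMeasure P₀] (ν : Measure W) [IsFiniteMeasure ν]
    {Λ : W → Ω → ℝ≥0∞} (hΛ : Measurable (Function.uncurry Λ))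
    (hprob : ∀ w, IsProbabilityMeasure (P₀.withDensity (Λ w)))
    (hν : 2⁻¹ ≤ ν Set.univ)
    (h2 : ∫⁻ w, ∫⁻ w', ∫⁻ x, Λ w x * Λ w' x ∂P₀ ∂ν ∂ν ≤ 2)
    {D : Set Ω} (hD : MeasurableSet D) :
    64⁻¹ ≤ P₀ D ∨ ∃ w, 64⁻¹ ≤ P₀.withDensity (Λ w) Dᶜ := by
  by_contra! hcon
  obtain ⟨h0, h1⟩ := hcon
  have hw : ∀ w, 63 / 64 ≤ P₀.withDensity (Λ w) D := by
    intro w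
    have := prob_add_prob_compl (μ := P₀.withDensity (Λ w)) hD
    by_contra! hlt
    have h3 : P₀.withDensity (Λ w) D + P₀.withDensity (Λ w) Dᶜ < 63 / 64 + 64⁻¹ :=
      ENNReal.add_lt_add hlt (h1 w)
    rw [this] at h3
    have : (63 / 64 + 64⁻¹ : ℝ≥0∞) = 1 := by
      rw [div_eq_mul_inv, ← add_one_mul]
      norm_num
      exact ENNReal.mul_inv_cancel (by norm_num) (by norm_num)
    rw [this] at h3
    exact lt_irrefl _ h3
  have hlow : 63 / 64 * 2⁻¹ ≤ ∫⁻ w, P₀.withDensity (Λ w) D ∂ν := by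
    calc (63 / 64 * 2⁻¹ : ℝ≥0∞) ≤ 63 / 64 * ν Set.univ := by gcongr
      _ = ∫⁻ _, 63 / 64 ∂ν := by rw [lintegral_const]
      _ ≤ _ := lintegral_mono hw
  have hswap : ∫⁻ w, P₀.withDensity (Λ w) D ∂ν
      = ∫⁻ x, D.indicator (fun x => ∫⁻ w, Λ w x ∂ν) x ∂P₀ := by
    rw [lintegral_indicator hD]
    simp_rw [withDensity_apply _ hD]
    exact lintegral_lintegral_swap hΛ.aemeasurable
  have hmix : Measurable fun x => ∫⁻ w, Λ w x ∂ν := hΛ.lintegral_prod_left'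
  have hsq : ∫⁻ x, (∫⁻ w, Λ w x ∂ν) * (∫⁻ w, Λ w x ∂ν) ∂P₀ ≤ 2 :=
    (lintegral_lintegral_mul_self P₀ ν hΛ).symm.trans_le h2
  -- The contradiction is numerical: this upper bound equals `3/8`, while `hlow` gives `63/128`.
  have hup : ∫⁻ w, P₀.withDensity (Λ w) D ∂ν ≤ 8⁻¹ * 2 + 8 * 64⁻¹ := by
    rw [hswap]
    refine (lintegral_mono fun x => indicator_le_sq_add D _ x).trans ?_
    have hmix2 : Measurable fun x => (∫⁻ w, Λ w x ∂ν) * ∫⁻ w, Λ w x ∂ν := hmix.mul hmix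
    rw [lintegral_add_left (hmix2.const_mul _), lintegral_const_mul _ hmix2,
      lintegral_indicator_const hD]
    gcongr
  have := hlow.trans hup
  have h4 := ENNReal.toReal_mono (by finiteness) this
  rw [ENNReal.toReal_add (by finiteness) (by finiteness)] at h4
  simp [ENNReal.toReal_mul, ENNReal.toReal_div] at h4
  norm_num at h4

/-- Markov's inequality for the `r`-th power. As `c ≤ 1`, `c ^ (1 / r) ≥ c`, which keeps the
constant independent of `r`. -/
theorem le_pointwiseRisk {d n : ℕ} (g : EuclideanSpace ℝ (Fin d) → ℝ) (p : ℝ → ℝ) {r : ℝ}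
    (hr : 1 ≤ r) (t : EuclideanSpace ℝ (Fin d))
    (Fhat : (Fin n → EuclideanSpace ℝ (Fin d) × ℝ) → EuclideanSpace ℝ (Fin d) → ℝ)
    (hF : IsEstimator Fhat) (F : EuclideanSpace ℝ (Fin d) → ℝ) {a : ℝ} {c : ℝ≥0∞} (hc : c ≤ 1)
    (h : c ≤ sampleLaw n g p F {data | a ≤ |Fhat data t - F t|}) :
    ENNReal.ofReal a * c ≤ pointwiseRisk g p r t Fhat F := by
  have hr0 : 0 < r := by linarith
  have hm : Measurable fun data => ENNReal.ofReal (|Fhat data t - F t|) ^ r :=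
    (((hF t).sub_const (F t)).abs.ennreal_ofReal).pow_const r
  have hmk := mul_meas_ge_le_lintegral (μ := sampleLaw n g p F) hm (ENNReal.ofReal a ^ r)
  have hsub : {data | a ≤ |Fhat data t - F t|} ⊆
      {data | ENNReal.ofReal a ^ r ≤ ENNReal.ofReal (|Fhat data t - F t|) ^ r} := by
    intro x hx
    exact ENNReal.rpow_le_rpow (ENNReal.ofReal_le_ofReal hx) hr0.le
  have h1 : ENNReal.ofReal a ^ r * c
      ≤ ∫⁻ data, ENNReal.ofReal (|Fhat data t - F t|) ^ r ∂(sampleLaw n g p F) :=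
    le_trans (mul_le_mul_right (h.trans (measure_mono hsub)) _) hmk
  have h2 := ENNReal.rpow_le_rpow h1 (by positivity : 0 ≤ 1 / r)
  unfold pointwiseRisk
  refine le_trans ?_ h2
  rw [ENNReal.mul_rpow_of_nonneg _ _ (by positivity : 0 ≤ 1 / r), ← ENNReal.rpow_mul,
    mul_one_div_cancel hr0.ne', ENNReal.rpow_one]
  gcongr
  calc c = c ^ (1 : ℝ) := (ENNReal.rpow_one c).symm
    _ ≤ c ^ (1 / r) := ENNReal.rpow_le_rpow_of_exponent_ge hc (by
        rw [div_le_one hr0]; exact hr)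

/-! ### Likelihood ratios of the regression model. -/

variable {d : ℕ} {g : EuclideanSpace ℝ (Fin d) → ℝ} {p : ℝ → ℝ}

theorem IsProbDensity.isProbabilityMeasure {E : Type*} [MeasureSpace E] {ρ : E → ℝ}
    (h : IsProbDensity ρ) :
    IsProbabilityMeasure ((volume : Measure E).withDensity fun x => ENNReal.ofReal (ρ x)) :=
  ⟨by rw [withDensity_apply _ MeasurableSet.univ, setLIntegral_univ, h.lintegral_eq_one]⟩

theorem measurable_obs {F : EuclideanSpace ℝ (Fin d) → ℝ} (hF : Measurable F) :
    Measurable fun z : EuclideanSpace ℝ (Fin d) × ℝ => (z.1, F z.1 + z.2) := by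
  fun_prop

theorem isProbabilityMeasure_obsLaw (hg : IsProbDensity g) (hp : IsProbDensity p)
    {F : EuclideanSpace ℝ (Fin d) → ℝ} (hF : Measurable F) :
    IsProbabilityMeasure (obsLaw g p F) := by
  have := hg.isProbabilityMeasure
  have := hp.isProbabilityMeasure
  exact Measure.isProbabilityMeasure_map (measurable_obs hF).aemeasurable

theorem lintegral_obsLaw (hg : IsProbDensity g) (hp : IsProbDensity p)
    {F : EuclideanSpace ℝ (Fin d) → ℝ} (hF : Measurable F)
    {φ : EuclideanSpace ℝ (Fin d) × ℝ → ℝ≥0∞} (hφ : Measurable φ) :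
    ∫⁻ z, φ z ∂obsLaw g p F
      = ∫⁻ x, ENNReal.ofReal (g x) * ∫⁻ y, ENNReal.ofReal (p (y - F x)) * φ (x, y) := by
  have := hg.isProbabilityMeasure
  have := hp.isProbabilityMeasure
  have hpm := hp.measurable
  have hgm := hg.measurable
  have hcomp : Measurable fun z : EuclideanSpace ℝ (Fin d) × ℝ => φ (z.1, F z.1 + z.2) :=
    hφ.comp (measurable_obs hF)
  rw [obsLaw, lintegral_map hφ (measurable_obs hF), lintegral_prod _ hcomp.aemeasurable,
    lintegral_withDensity_eq_lintegral_mul _ hgm.ennreal_ofReal]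
  · refine lintegral_congr fun x => ?_
    simp only [Pi.mul_apply]
    congr 1
    have hx : Measurable fun y => φ (x, F x + y) := hcomp.comp measurable_prodMk_left
    rw [lintegral_withDensity_eq_lintegral_mul _ hpm.ennreal_ofReal hx,
      ← lintegral_sub_right_eq_self (fun a =>
        ((fun y => ENNReal.ofReal (p y)) * fun a => φ (x, F x + a)) a) (F x)]
    simp
  · exact hcomp.lintegral_prod_right'

/-- The likelihood ratio of one observation with regression function `F` against the pure noise
model. -/
noncomputable def likelihoodRatio (p : ℝ → ℝ) (F : EuclideanSpace ℝ (Fin d) → ℝ)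
    (z : EuclideanSpace ℝ (Fin d) × ℝ) : ℝ≥0∞ :=
  ENNReal.ofReal (p (z.2 - F z.1)) / ENNReal.ofReal (p z.2)

theorem measurable_likelihoodRatio (hp : Measurable p) {F : EuclideanSpace ℝ (Fin d) → ℝ}
    (hF : Measurable F) : Measurable (likelihoodRatio p F) := by
  unfold likelihoodRatio
  fun_prop

/-- The noise condition at `v₁ = v₂` has a finite integral, so its integrand is finite a.e.; since
`a / 0 = ∞` for `a > 0`, the shifted density vanishes a.e. where `p` does. -/
theorem NoiseCondition.ae_ac {q Q v : ℝ} (hp : Measurable p) (hnoise : NoiseCondition q Q p)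
    (hv : |v| ≤ q) :
    ∀ᵐ y, ENNReal.ofReal (p y) * (ENNReal.ofReal (p (y - v)) / ENNReal.ofReal (p y))
      = ENNReal.ofReal (p (y - v)) := by
  have hmem : -v ∈ Set.Icc (-q) q := abs_le.1 (by rwa [abs_neg])
  have hfin := (hnoise (-v) hmem (-v) hmem).trans_lt ENNReal.ofReal_lt_top
  filter_upwards [ae_lt_top (by fun_prop) hfin.ne] with y hy
  rw [← sub_eq_add_neg] at hy
  rcases eq_or_ne (ENNReal.ofReal (p y)) 0 with h0 | h0
  · rw [h0, zero_mul]
    by_contra hne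
    rw [h0, ENNReal.div_zero] at hy
    · exact lt_irrefl _ hy
    · exact mul_ne_zero (Ne.symm hne) (Ne.symm hne)
  · exact ENNReal.mul_div_cancel h0 ENNReal.ofReal_ne_top

theorem obsLaw_eq_withDensity {q Q : ℝ} (hg : IsProbDensity g) (hp : IsProbDensity p)
    (hnoise : NoiseCondition q Q p) {F : EuclideanSpace ℝ (Fin d) → ℝ} (hF : Measurable F)
    (hFq : ∀ x, |F x| ≤ q) :
    obsLaw g p F = (obsLaw g p fun _ => 0).withDensity (likelihoodRatio p F) := by
  have hl := measurable_likelihoodRatio hp.measurable hF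
  refine Measure.ext_of_lintegral _ fun φ hφ => ?_
  rw [lintegral_withDensity_eq_lintegral_mul _ hl hφ, lintegral_obsLaw hg hp hF hφ,
    lintegral_obsLaw hg hp measurable_const (hl.mul hφ)]
  refine lintegral_congr fun x => ?_
  congr 1
  refine lintegral_congr_ae ?_
  filter_upwards [hnoise.ae_ac hp.measurable (hFq x)] with y hy
  simp only [Pi.mul_apply, likelihoodRatio, sub_zero]
  rw [← mul_assoc, hy]

theorem lintegral_likelihoodRatio_mul_le {q Q : ℝ} (hg : IsProbDensity g) (hp : IsProbDensity p)
    (hnoise : NoiseCondition q Q p) {F F' : EuclideanSpace ℝ (Fin d) → ℝ} (hF : Measurable F)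
    (hF' : Measurable F') (hFq : ∀ x, |F x| ≤ q) (hFq' : ∀ x, |F' x| ≤ q) :
    ∫⁻ z, likelihoodRatio p F z * likelihoodRatio p F' z ∂obsLaw g p (fun _ => 0)
      ≤ ∫⁻ x, ENNReal.ofReal (g x) * ENNReal.ofReal (1 + Q * |F x * F' x|) := by
  have hpm := hp.measurable
  rw [lintegral_obsLaw hg hp measurable_const
    (φ := fun z => likelihoodRatio p F z * likelihoodRatio p F' z)
    ((measurable_likelihoodRatio hpm hF).mul (measurable_likelihoodRatio hpm hF'))]
  refine lintegral_mono fun x => ?_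
  gcongr
  have h := hnoise (-F x) (abs_le.1 (by rw [abs_neg]; exact hFq x)) (-F' x)
    (abs_le.1 (by rw [abs_neg]; exact hFq' x))
  rw [neg_mul_neg] at h
  refine le_trans (lintegral_mono fun y => ?_) h
  simp only [likelihoodRatio, sub_zero, ← sub_eq_add_neg]
  rcases eq_or_ne (ENNReal.ofReal (p y)) 0 with h0 | h0
  -- Where `p` vanishes, the outer weight `p y` makes the left side zero whatever the ratios are.
  · simp [h0]
  · rw [← mul_assoc, ENNReal.mul_div_cancel h0 ENNReal.ofReal_ne_top, mul_div_assoc]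

theorem sampleLaw_eq_withDensity {q Q : ℝ} (n : ℕ) (hg : IsProbDensity g) (hp : IsProbDensity p)
    (hnoise : NoiseCondition q Q p) {F : EuclideanSpace ℝ (Fin d) → ℝ} (hF : Measurable F)
    (hFq : ∀ x, |F x| ≤ q) :
    sampleLaw n g p F = (sampleLaw n g p fun _ => 0).withDensity
      fun data => ∏ i, likelihoodRatio p F (data i) := by
  have h := obsLaw_eq_withDensity hg hp hnoise hF hFq
  have := isProbabilityMeasure_obsLaw hg hp (F := fun _ => 0) measurable_const
  have := isProbabilityMeasure_obsLaw hg hp hF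
  rw [sampleLaw, h]
  rw [h] at this
  exact pi_withDensity _ (measurable_likelihoodRatio hp.measurable hF)

theorem isProbabilityMeasure_sampleLaw (n : ℕ) (hg : IsProbDensity g) (hp : IsProbDensity p)
    {F : EuclideanSpace ℝ (Fin d) → ℝ} (hF : Measurable F) :
    IsProbabilityMeasure (sampleLaw n g p F) := by
  have := isProbabilityMeasure_obsLaw hg hp hF
  unfold sampleLaw
  infer_instance

/-! ### Random directions and the overlap of slabs. -/

/-- In an orthonormal basis starting with `y / ‖y‖`, the set lies in a box with one side `2h / ‖y‖`
and `d - 1` sides of length `2`. -/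
theorem volume_slab_inter_ball_le (hd : 0 < d) {y : EuclideanSpace ℝ (Fin d)} (hy : y ≠ 0)
    (h : ℝ) :
    volume ({w : EuclideanSpace ℝ (Fin d) | |inner ℝ y w| ≤ h} ∩ Metric.ball 0 1)
      ≤ ENNReal.ofReal (2 ^ d * (h / ‖y‖)) := by
  have hy0 : 0 < ‖y‖ := norm_pos_iff.2 hy
  let i₀ : Fin d := ⟨0, hd⟩
  obtain ⟨b, hb⟩ := Orthonormal.exists_orthonormalBasis_extension_of_card_eq (𝕜 := ℝ)
    (E := EuclideanSpace ℝ (Fin d)) (ι := Fin d) (by simp)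
    (v := fun _ => ‖y‖⁻¹ • y) (s := {i₀}) (by
      constructor
      · intro i
        simp [norm_smul, hy0.ne']
      · intro i j hij
        exact absurd (Subsingleton.elim i j) hij)
  have hb0 : b i₀ = ‖y‖⁻¹ • y := hb i₀ rfl
  let R : Fin d → Set ℝ := fun i =>
    if i = i₀ then Set.Icc (-(h / ‖y‖)) (h / ‖y‖) else Set.Icc (-1) 1
  have hsub : {w : EuclideanSpace ℝ (Fin d) | |inner ℝ y w| ≤ h} ∩ Metric.ball 0 1 ⊆
      b.repr ⁻¹' (WithLp.ofLp ⁻¹' (Set.univ.pi R)) := by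
    rintro w ⟨hw, hw1⟩ i -
    rw [mem_ball_zero_iff] at hw1
    change b.repr w i ∈ R i
    rw [b.repr_apply_apply]
    by_cases hi : i = i₀
    · simp only [R, if_pos hi]
      rw [hi, hb0, inner_smul_left, Set.mem_Icc, ← abs_le, abs_mul]
      simp only [map_inv₀, conj_trivial, abs_inv, abs_norm]
      rw [inv_mul_eq_div]
      exact div_le_div_of_nonneg_right hw hy0.le
    · simp only [R, if_neg hi]
      rw [Set.mem_Icc, ← abs_le]
      refine (abs_real_inner_le_norm _ _).trans ?_
      rw [b.orthonormal.1 i, one_mul]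
      exact hw1.le
  have hR : MeasurableSet (Set.univ.pi R) := by
    refine MeasurableSet.univ_pi fun i => ?_
    simp only [R]
    split_ifs <;> exact measurableSet_Icc
  refine (measure_mono hsub).trans ?_
  have hofLp := PiLp.volume_preserving_ofLp (Fin d)
  rw [b.measurePreserving_repr.measure_preimage (hofLp.measurable hR).nullMeasurableSet,
    hofLp.measure_preimage hR.nullMeasurableSet, volume_pi_pi,
    ← Finset.mul_prod_erase _ _ (Finset.mem_univ i₀)]
  have herase : ∏ i ∈ Finset.univ.erase i₀, volume (R i) = ENNReal.ofReal 2 ^ (d - 1) := by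
    rw [Finset.prod_congr rfl (g := fun _ => ENNReal.ofReal 2), Finset.prod_const,
      Finset.card_erase_of_mem (Finset.mem_univ _), Finset.card_univ, Fintype.card_fin]
    intro i hi
    simp only [R, if_neg (Finset.ne_of_mem_erase hi), Real.volume_Icc]
    norm_num
  rw [herase, ← ENNReal.ofReal_pow (by norm_num), mul_comm]
  simp only [R, if_true, Real.volume_Icc]
  rw [← ENNReal.ofReal_mul (by positivity)]
  refine ENNReal.ofReal_le_ofReal (le_of_eq ?_)
  obtain ⟨k, rfl⟩ : ∃ k, d = k + 1 := ⟨d - 1, by omega⟩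
  simp only [Nat.add_sub_cancel]
  ring

/-- A measurable family of unit vectors together with a prior under which no nonzero direction is
nearly orthogonal with large probability. -/
theorem exists_direction_prior (hd : 0 < d) :
    ∃ (μ : Measure (EuclideanSpace ℝ (Fin d)))
      (θ : EuclideanSpace ℝ (Fin d) → EuclideanSpace ℝ (Fin d)) (C : ℝ),
      IsProbabilityMeasure μ ∧ Measurable θ ∧ (∀ w, ‖θ w‖ = 1) ∧ 0 < C ∧
      ∀ y : EuclideanSpace ℝ (Fin d), y ≠ 0 → ∀ h : ℝ, 0 < h →
        μ {w | |inner ℝ y (θ w)| ≤ h} ≤ ENNReal.ofReal (C * h * ‖y‖⁻¹) := by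
  set B : Set (EuclideanSpace ℝ (Fin d)) := Metric.ball 0 1
  have hB0 : volume B ≠ 0 := (Metric.measure_ball_pos volume _ one_pos).ne'
  have hBt : volume B ≠ ∞ := measure_ball_lt_top.ne
  have hBpos : 0 < (volume B).toReal := ENNReal.toReal_pos hB0 hBt
  let e : EuclideanSpace ℝ (Fin d) := EuclideanSpace.single ⟨0, hd⟩ 1
  let θ : EuclideanSpace ℝ (Fin d) → EuclideanSpace ℝ (Fin d) :=
    fun w => if w = 0 then e else ‖w‖⁻¹ • w
  refine ⟨ProbabilityTheory.cond volume B, θ, (volume B).toReal⁻¹ * 2 ^ d,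
    ProbabilityTheory.cond_isProbabilityMeasure_of_finite hB0 hBt, ?_, ?_, by positivity, ?_⟩
  · exact Measurable.ite (measurableSet_singleton 0) measurable_const (by fun_prop)
  · intro w
    by_cases hw : w = 0
    · simp [θ, hw, e]
    · have : ‖w‖ ≠ 0 := norm_ne_zero_iff.2 hw
      simp [θ, hw, norm_smul, this]
  · intro y hy h hh
    rw [ProbabilityTheory.cond_apply measurableSet_ball]
    -- The prior is uniform on the ball and `θ` is radial projection; since `‖w‖ ≤ 1`, passing from
    -- `θ w` to `w` only shrinks the inner product.
    have hsub : B ∩ {w | |inner ℝ y (θ w)| ≤ h}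
        ⊆ {w : EuclideanSpace ℝ (Fin d) | |inner ℝ y w| ≤ h} ∩ B := by
      rintro w ⟨hwB, hw⟩
      refine ⟨?_, hwB⟩
      have hw1 : ‖w‖ ≤ 1 := (mem_ball_zero_iff.1 hwB).le
      have hwθ : w = ‖w‖ • θ w := by
        by_cases hw0 : w = 0
        · simp [hw0]
        · simp [θ, hw0, smul_smul]
      rw [Set.mem_ofPred_eq, hwθ, inner_smul_right, abs_mul, abs_norm]
      exact (mul_le_of_le_one_left (abs_nonneg _) hw1).trans hw
    calc (volume B)⁻¹ * volume (B ∩ {w | |inner ℝ y (θ w)| ≤ h})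
        ≤ (volume B)⁻¹ * ENNReal.ofReal (2 ^ d * (h / ‖y‖)) := by
          gcongr
          exact (measure_mono hsub).trans (volume_slab_inter_ball_le hd hy h)
      _ = ENNReal.ofReal ((volume B).toReal⁻¹ * 2 ^ d * h * ‖y‖⁻¹) := by
          rw [← ENNReal.ofReal_toReal (ENNReal.inv_ne_top.2 hB0), ENNReal.toReal_inv,
            ← ENNReal.ofReal_mul (by positivity)]
          congr 1
          ring

/-- Near `t` the density is at most `G` and the kernel is integrable because `3/2 < 2 ≤ d`; at
distance at least `1` the kernel is at most `1`. The constant is uniform in `g` and `t`. -/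
theorem exists_moment_bound (hd : 2 ≤ d) {G : ℝ} (hG : 0 < G) :
    ∃ C : ℝ, 0 < C ∧ ∀ g : EuclideanSpace ℝ (Fin d) → ℝ, IsProbDensity g → (∀ x, g x ≤ G) →
      ∀ t, ∫⁻ x, ENNReal.ofReal (g x) * ENNReal.ofReal (‖x - t‖ ^ (-(3 / 2) : ℝ))
        ≤ ENNReal.ofReal C := by
  set k : EuclideanSpace ℝ (Fin d) → ℝ := fun x => ‖x‖ ^ (-(3 / 2) : ℝ) with hk
  have hkm : Measurable k := by fun_prop
  have hk0 : ∀ x, 0 ≤ k x := fun x => Real.rpow_nonneg (norm_nonneg x) _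
  have hint : IntegrableOn k (Metric.ball 0 1) := by
    refine integrableOn_ball_of_norm_le_rpow (C := 1) (α := 3 / 2) ?_ ?_ ?_
      hkm.aestronglyMeasurable
    · simp; omega
    · simp only [finrank_euclideanSpace, Fintype.card_fin]
      have : (2 : ℝ) ≤ d := by exact_mod_cast hd
      linarith
    · exact Filter.Eventually.of_forall fun x => by
        rw [Real.norm_of_nonneg (hk0 x), one_mul]
  set I : ℝ≥0∞ := ∫⁻ x in Metric.ball 0 1, ENNReal.ofReal (k x) with hI
  have hIt : I ≠ ∞ := hint.lintegral_lt_top.ne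
  refine ⟨G * I.toReal + 1, by positivity, fun g hg hgG t => ?_⟩
  set u : EuclideanSpace ℝ (Fin d) → ℝ≥0∞ :=
    (Metric.ball 0 1).indicator fun x => ENNReal.ofReal (k x)
  have hum : Measurable u := hkm.ennreal_ofReal.indicator measurableSet_ball
  calc ∫⁻ x, ENNReal.ofReal (g x) * ENNReal.ofReal (k (x - t))
      ≤ ∫⁻ x, (ENNReal.ofReal G * u (x - t) + ENNReal.ofReal (g x)) := by
        refine lintegral_mono fun x => ?_
        by_cases hx : x - t ∈ Metric.ball 0 1
        · refine le_trans ?_ le_self_add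
          simp only [u, Set.indicator_of_mem hx]
          gcongr
          exact hgG x
        · refine le_trans ?_ le_add_self
          refine mul_le_of_le_one_right' ?_
          rw [ENNReal.ofReal_le_one]
          refine Real.rpow_le_one_of_one_le_of_nonpos ?_ (by norm_num)
          simpa using hx
    _ = ENNReal.ofReal G * I + 1 := by
        rw [lintegral_add_right _ hg.measurable.ennreal_ofReal, hg.lintegral_eq_one,
          lintegral_const_mul _ (f := fun x => u (x - t)) (hum.comp (measurable_sub_const t)),
          lintegral_sub_right_eq_self u t, lintegral_indicator measurableSet_ball]
    _ = ENNReal.ofReal (G * I.toReal + 1) := by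
        rw [ENNReal.ofReal_add (by positivity) zero_le_one, ENNReal.ofReal_mul hG.le,
          ENNReal.ofReal_toReal hIt, ENNReal.ofReal_one]

/-- The exponent `3/2` lies above `1`, which gives a gain over a single slab, and below `2`, which
keeps the moment finite even for `d = 2`. -/
theorem mul_self_le_of_le_one {m : ℝ≥0∞} {a : ℝ} (ha : 0 < a) (h1 : m ≤ 1)
    (hm : m ≤ ENNReal.ofReal a) : m * m ≤ ENNReal.ofReal (a ^ (3 / 2 : ℝ)) := by
  rcases le_total a 1 with h | h
  · refine (mul_le_mul' hm hm).trans ?_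
    rw [← ENNReal.ofReal_mul ha.le]
    refine ENNReal.ofReal_le_ofReal ?_
    calc a * a = a ^ (2 : ℝ) := by rw [Real.rpow_two]; ring
      _ ≤ a ^ (3 / 2 : ℝ) := Real.rpow_le_rpow_of_exponent_ge ha h (by norm_num)
  · refine (mul_le_mul' h1 h1).trans ?_
    rw [one_mul, ENNReal.one_le_ofReal]
    exact Real.one_le_rpow h (by norm_num)

theorem inv_le_one_add_rpow {u : ℝ} (hu : 0 < u) : u⁻¹ ≤ 1 + u ^ (-(3 / 2) : ℝ) := by
  rcases le_total u 1 with h | h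
  · rw [← Real.rpow_neg_one]
    have : u ^ (-1 : ℝ) ≤ u ^ (-(3 / 2) : ℝ) :=
      Real.rpow_le_rpow_of_exponent_ge hu h (by norm_num)
    linarith
  · have := inv_le_one_of_one_le₀ h
    have := Real.rpow_nonneg hu.le (-(3 / 2))
    linarith

/-- The slab of half-width `h` around the hyperplane through `t` orthogonal to `θ`. -/
def slab (t θ : EuclideanSpace ℝ (Fin d)) (h : ℝ) : Set (EuclideanSpace ℝ (Fin d)) :=
  {x | |inner ℝ (x - t) θ| ≤ h}

theorem measurableSet_slab (t θ : EuclideanSpace ℝ (Fin d)) (h : ℝ) :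
    MeasurableSet (slab t θ h) :=
  measurableSet_le (by fun_prop) measurable_const

/-- Averages over directions do not suffice: the slab mass will also appear in an exponent and must
be bounded there for almost every direction. Directions with heavy slabs are therefore discarded.
`θ` and `C` are fixed before `g`, `t` and `h`, as the uniformity of the final constant requires. -/
theorem exists_localized_prior (hd : 2 ≤ d) {G : ℝ} (hG : 0 < G) :
    ∃ (θ : EuclideanSpace ℝ (Fin d) → EuclideanSpace ℝ (Fin d)) (C : ℝ),
      Measurable θ ∧ (∀ w, ‖θ w‖ = 1) ∧ 0 < C ∧
      ∀ g : EuclideanSpace ℝ (Fin d) → ℝ, IsProbDensity g → (∀ x, g x ≤ G) →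
      ∀ (t : EuclideanSpace ℝ (Fin d)) (h : ℝ), 0 < h →
      ∃ ν : Measure (EuclideanSpace ℝ (Fin d)), 2⁻¹ ≤ ν Set.univ ∧ ν Set.univ ≤ 1 ∧
        (∀ᵐ w ∂ν, volume.withDensity (fun x => ENNReal.ofReal (g x)) (slab t (θ w) h)
          ≤ ENNReal.ofReal (C * h)) ∧
        ∫⁻ w, ∫⁻ w', volume.withDensity (fun x => ENNReal.ofReal (g x))
          (slab t (θ w) h ∩ slab t (θ w') h) ∂ν ∂ν ≤ ENNReal.ofReal (C * h ^ (3 / 2 : ℝ)) := by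
  obtain ⟨μ, θ, C₁, hμ, hθ, hθ1, hC₁, hslab⟩ := exists_direction_prior (d := d) (by omega)
  obtain ⟨C₂, hC₂, hmom⟩ := exists_moment_bound hd hG
  -- The factor `2` is the Markov threshold defining the good directions; the second entry comes
  -- from the pair overlap.
  set C := max (2 * (C₁ * (1 + C₂))) (C₁ ^ (3 / 2 : ℝ) * C₂) with hC
  have hC0 : 0 < C := lt_max_of_lt_left (by positivity)
  refine ⟨θ, C, hθ, hθ1, hC0, fun g hg hgG t h hh => ?_⟩
  set P := (volume : Measure (EuclideanSpace ℝ (Fin d))).withDensity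
    fun x => ENNReal.ofReal (g x) with hP
  have hPprob : IsProbabilityMeasure P := hg.isProbabilityMeasure
  have hgm := hg.measurable.ennreal_ofReal
  set f : EuclideanSpace ℝ (Fin d) → EuclideanSpace ℝ (Fin d) → ℝ≥0∞ :=
    fun w => (slab t (θ w) h).indicator 1 with hf
  have hfm : Measurable (Function.uncurry f) := by
    have : Function.uncurry f = Set.indicator
        {z : EuclideanSpace ℝ (Fin d) × EuclideanSpace ℝ (Fin d) |
          |inner ℝ (z.2 - t) (θ z.1)| ≤ h} 1 := by
      ext ⟨w, x⟩
      rfl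
    rw [this]
    exact measurable_one.indicator (measurableSet_le (by fun_prop) measurable_const)
  have hfP : ∀ w, ∫⁻ x, f w x ∂P = P (slab t (θ w) h) := fun w =>
    lintegral_indicator_one (measurableSet_slab _ _ _)
  have hPm : Measurable fun w => P (slab t (θ w) h) := by
    simp_rw [← hfP]
    exact hfm.lintegral_prod_right'
  have hfμ : ∀ x, ∫⁻ w, f w x ∂μ = μ {w | |inner ℝ (x - t) (θ w)| ≤ h} := by
    intro x
    rw [← lintegral_indicator_one (measurableSet_le (by fun_prop) measurable_const)]
    rfl
  have hnt : Nontrivial (EuclideanSpace ℝ (Fin d)) :=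
    Module.nontrivial_of_finrank_pos (R := ℝ) (by simp; omega)
  have hae : ∀ᵐ x ∂P, x ≠ t := by
    refine (withDensity_absolutelyContinuous volume _).ae_le ?_
    change ∀ᵐ x, x ≠ t
    rw [ae_iff]
    simp
  have hmomP : ∫⁻ x, ENNReal.ofReal (‖x - t‖ ^ (-(3 / 2) : ℝ)) ∂P ≤ ENNReal.ofReal C₂ := by
    rw [hP, lintegral_withDensity_eq_lintegral_mul _ hgm (by fun_prop)]
    exact hmom g hg hgG t
  have hone : ∫⁻ w, P (slab t (θ w) h) ∂μ ≤ ENNReal.ofReal (C₁ * (1 + C₂) * h) := by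
    simp_rw [← hfP]
    rw [lintegral_lintegral_swap hfm.aemeasurable]
    calc ∫⁻ x, ∫⁻ w, f w x ∂μ ∂P
        ≤ ∫⁻ x, ENNReal.ofReal (C₁ * h) *
            (1 + ENNReal.ofReal (‖x - t‖ ^ (-(3 / 2) : ℝ))) ∂P := by
          refine lintegral_mono_ae ?_
          filter_upwards [hae] with x hx
          have hx0 : 0 < ‖x - t‖ := norm_pos_iff.2 (sub_ne_zero.2 hx)
          rw [hfμ]
          refine (hslab _ (sub_ne_zero.2 hx) h hh).trans ?_
          rw [← ENNReal.ofReal_one, ← ENNReal.ofReal_add zero_le_one (by positivity),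
            ← ENNReal.ofReal_mul (by positivity)]
          exact ENNReal.ofReal_le_ofReal
            (mul_le_mul_of_nonneg_left (inv_le_one_add_rpow hx0) (by positivity))
      _ ≤ ENNReal.ofReal (C₁ * h) * (1 + ENNReal.ofReal C₂) := by
          rw [lintegral_const_mul _ (by fun_prop), lintegral_add_left measurable_const]
          simp only [lintegral_const, measure_univ, mul_one]
          gcongr
      _ = _ := by
          rw [← ENNReal.ofReal_one, ← ENNReal.ofReal_add zero_le_one hC₂.le,
            ← ENNReal.ofReal_mul (by positivity)]
          congr 1
          ring
  -- By Tonelli this is the `P`-integral of the squared probability that a random slab covers `x`,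
  -- and that probability is at most `min 1 (C₁ h / ‖x - t‖)`.
  have htwo : ∫⁻ w, ∫⁻ w', P (slab t (θ w) h ∩ slab t (θ w') h) ∂μ ∂μ
      ≤ ENNReal.ofReal (C₁ ^ (3 / 2 : ℝ) * C₂ * h ^ (3 / 2 : ℝ)) := by
    have hinter : ∀ w w', P (slab t (θ w) h ∩ slab t (θ w') h) = ∫⁻ x, f w x * f w' x ∂P := by
      intro w w'
      rw [← lintegral_indicator_one ((measurableSet_slab _ _ _).inter (measurableSet_slab _ _ _)),
        Set.inter_indicator_one]
      rfl
    simp_rw [hinter]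
    rw [lintegral_lintegral_mul_self P μ hfm]
    calc ∫⁻ x, (∫⁻ w, f w x ∂μ) * (∫⁻ w, f w x ∂μ) ∂P
        ≤ ∫⁻ x, ENNReal.ofReal ((C₁ * h) ^ (3 / 2 : ℝ)) *
            ENNReal.ofReal (‖x - t‖ ^ (-(3 / 2) : ℝ)) ∂P := by
          refine lintegral_mono_ae ?_
          filter_upwards [hae] with x hx
          have hx0 : 0 < ‖x - t‖ := norm_pos_iff.2 (sub_ne_zero.2 hx)
          rw [hfμ]
          refine (mul_self_le_of_le_one (by positivity) prob_le_one
            (hslab _ (sub_ne_zero.2 hx) h hh)).trans (le_of_eq ?_)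
          rw [← ENNReal.ofReal_mul (by positivity), Real.mul_rpow (by positivity) (by positivity),
            Real.inv_rpow hx0.le, Real.rpow_neg hx0.le]
      _ ≤ ENNReal.ofReal ((C₁ * h) ^ (3 / 2 : ℝ)) * ENNReal.ofReal C₂ := by
          rw [lintegral_const_mul _ (by fun_prop)]
          gcongr
      _ = _ := by
          rw [← ENNReal.ofReal_mul (by positivity), Real.mul_rpow hC₁.le hh.le]
          congr 1
          ring
  set M : ℝ≥0∞ := ENNReal.ofReal (C₁ * (1 + C₂) * h) with hM
  have hM0 : M ≠ 0 := by
    rw [hM, Ne, ENNReal.ofReal_eq_zero, not_le]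
    positivity
  have hMt : M ≠ ∞ := ENNReal.ofReal_ne_top
  -- Directions whose slab mass is below twice the bound on its mean; by Markov they carry at least
  -- half of the prior.
  set good : Set (EuclideanSpace ℝ (Fin d)) := {w | 2 * M ≤ P (slab t (θ w) h)}ᶜ with hgood
  have hgoodm : MeasurableSet good := (measurableSet_le measurable_const hPm).compl
  have hbad : μ goodᶜ ≤ 2⁻¹ := by
    have hmk := (mul_meas_ge_le_lintegral (μ := μ) hPm (2 * M)).trans hone
    rw [hgood, compl_compl]
    rw [mul_assoc, mul_left_comm] at hmk
    have h2 := (ENNReal.mul_le_mul_iff_right hM0 hMt).1 (hmk.trans_eq (mul_one M).symm)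
    rwa [mul_comm, ← ENNReal.le_inv_iff_mul_le] at h2
  -- The restriction is not renormalised: total mass at least `1/2` is enough for the test, and
  -- restricting can only decrease the overlap integral.
  refine ⟨μ.restrict good, ?_, ?_, ?_, ?_⟩
  · rw [Measure.restrict_apply_univ]
    have hsum := prob_add_prob_compl (μ := μ) hgoodm
    by_contra! hlt
    have := ENNReal.add_lt_add_of_lt_of_le (by finiteness) hlt hbad
    rw [hsum, ENNReal.inv_two_add_inv_two] at this
    exact lt_irrefl _ this
  · rw [Measure.restrict_apply_univ]
    exact prob_le_one
  · filter_upwards [ae_restrict_mem hgoodm] with w hw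
    have hw' : P (slab t (θ w) h) < 2 * M := not_le.1 hw
    refine hw'.le.trans ?_
    rw [hM, ← ENNReal.ofReal_ofNat, ← ENNReal.ofReal_mul (by norm_num)]
    refine ENNReal.ofReal_le_ofReal ?_
    rw [← mul_assoc]
    exact mul_le_mul_of_nonneg_right (le_max_left _ _) hh.le
  · refine le_trans ?_ (htwo.trans ?_)
    · refine (lintegral_mono' Measure.restrict_le_self le_rfl).trans ?_
      exact lintegral_mono fun w => lintegral_mono' Measure.restrict_le_self le_rfl
    · refine ENNReal.ofReal_le_ofReal ?_
      exact mul_le_mul_of_nonneg_right (le_max_right _ _) (by positivity)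

/-! ### Rescaled bumps in the Hölder class. -/

theorem tsupport_iteratedDeriv_subset (f : ℝ → ℝ) (m : ℕ) :
    tsupport (iteratedDeriv m f) ⊆ tsupport f := by
  induction m with
  | zero => simp
  | succ m ih =>
    rw [iteratedDeriv_succ]
    exact (closure_minimal support_deriv_subset isClosed_closure).trans ih

theorem exists_bump (k : ℕ) :
    ∃ (φ : ℝ → ℝ) (M : ℝ), 1 ≤ M ∧ (∀ m : ℕ, ContDiff ℝ m φ) ∧ φ 0 = 1 ∧ (∀ u, 0 ≤ φ u) ∧
      (∀ u, φ u ≤ 1) ∧ (∀ u, 1 < |u| → φ u = 0) ∧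
      ∀ m ≤ k, ∀ u, |iteratedDeriv m φ u| ≤ M := by
  let φ : ContDiffBump (0 : ℝ) := ⟨1 / 2, 1, by norm_num, by norm_num⟩
  have hφ : ∀ m : ℕ, ContDiff ℝ m φ := fun m => φ.contDiff
  have hb : ∀ m : ℕ, ∃ C, ∀ u, ‖iteratedDeriv m φ u‖ ≤ C := by
    intro m
    refine HasCompactSupport.exists_bound_of_continuous ?_
      ((hφ m).continuous_iteratedDeriv m le_rfl)
    exact φ.hasCompactSupport.of_isClosed_subset isClosed_closure
      (tsupport_iteratedDeriv_subset _ _)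
  choose C hC using hb
  refine ⟨φ, 1 + ∑ m ∈ Finset.range (k + 1), |C m|, ?_, hφ, ?_, fun u => φ.nonneg, fun u => φ.le_one,
    ?_, ?_⟩
  · have := Finset.sum_nonneg fun m (_ : m ∈ Finset.range (k + 1)) => abs_nonneg (C m)
    linarith
  · exact φ.one_of_mem_closedBall (by simp [φ])
  · intro u hu
    exact φ.zero_of_le_dist (by simpa [φ] using hu.le)
  · intro m hm u
    have h1 := Finset.single_le_sum (fun m _ => abs_nonneg (C m))
      (Finset.mem_range.2 (Nat.lt_succ_of_le hm))
    have h2 := hC m u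
    rw [Real.norm_eq_abs] at h2
    have h3 := le_abs_self (C m)
    linarith

theorem iteratedDeriv_rescale {φ : ℝ → ℝ} {m : ℕ} (hφ : ContDiff ℝ m φ) (A c s u : ℝ) :
    iteratedDeriv m (fun u => A * φ (c * (u - s))) u
      = A * (c ^ m * iteratedDeriv m φ (c * (u - s))) := by
  rw [iteratedDeriv_const_mul_field A (fun u => φ (c * (u - s)))]
  rw [iteratedDeriv_comp_sub_const m (fun v => φ (c * v)) s]
  simp only
  rw [iteratedDeriv_comp_const_mul hφ c]

theorem holderOrder_lt {β : ℝ} (hβ : 0 < β) : (holderOrder β : ℝ) < β := by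
  have h := Nat.ceil_lt_add_one hβ.le
  have h1 : 0 < ⌈β⌉₊ := Nat.ceil_pos.2 hβ
  rw [holderOrder, Nat.cast_sub h1]
  push_cast
  linarith

theorem le_holderOrder_add_one {β : ℝ} (hβ : 0 < β) : β ≤ holderOrder β + 1 := by
  have h := Nat.le_ceil β
  have h1 : 0 < ⌈β⌉₊ := Nat.ceil_pos.2 hβ
  rw [holderOrder, Nat.cast_sub h1]
  push_cast
  linarith

/-- Each derivative costs `h⁻¹`, and the amplitude `h^β` pays for all orders up to `holderOrder β`
since `h ≤ 1`. One derivative beyond that order is controlled to get a Lipschitz bound at the top.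
-/
theorem rescaled_bump_mem_holderClass {β L h M : ℝ} (hβ : 0 < β) (hL : 0 < L) (hh : 0 < h)
    (hh1 : h ≤ 1) (hM : 1 ≤ M) {φ : ℝ → ℝ} (hφ : ∀ m : ℕ, ContDiff ℝ m φ)
    (hφM : ∀ m ≤ holderOrder β + 1, ∀ u, |iteratedDeriv m φ u| ≤ M) (s : ℝ) :
    (fun u => L * h ^ β / (2 * M) * φ (h⁻¹ * (u - s))) ∈ holderClass β L := by
  set A := L * h ^ β / (2 * M) with hA
  set k := holderOrder β with hk
  have hM0 : 0 < M := by linarith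
  have hA0 : 0 < A := by positivity
  have hkβ : (k : ℝ) < β := holderOrder_lt hβ
  have hβk : β - k ≤ 1 := by linarith [le_holderOrder_add_one hβ]
  have hpow : ∀ m : ℕ, A * (h⁻¹) ^ m = L / (2 * M) * h ^ (β - m) := by
    intro m
    rw [Real.rpow_sub hh, Real.rpow_natCast, hA, inv_pow]
    ring
  refine ⟨?_, ?_, ?_⟩
  · have := hφ k
    fun_prop
  · intro m hm u
    rw [iteratedDeriv_rescale (hφ m), ← mul_assoc, hpow, abs_mul, abs_of_nonneg (by positivity)]
    have hmβ : (m : ℝ) ≤ k := by exact_mod_cast hm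
    have h1 : h ^ (β - m) ≤ 1 := Real.rpow_le_one hh.le hh1 (by linarith)
    calc L / (2 * M) * h ^ (β - m) * |iteratedDeriv m φ (h⁻¹ * (u - s))|
        ≤ L / (2 * M) * 1 * M := by
          gcongr
          exact hφM m (by omega) _
      _ = L / 2 := by field_simp
      _ ≤ L := by linarith
  · intro u δ hδ
    rw [iteratedDeriv_rescale (hφ k), iteratedDeriv_rescale (hφ k), ← mul_sub, ← mul_sub,
      ← mul_assoc, hpow, abs_mul, abs_of_nonneg (by positivity)]
    set x := h⁻¹ * (u - s)
    set y := h⁻¹ * (u + δ - s)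
    have hxy : y - x = δ / h := by simp only [x, y]; ring
    have hlip : |iteratedDeriv k φ y - iteratedDeriv k φ x| ≤ M * (δ / h) := by
      have hdiff : Differentiable ℝ (iteratedDeriv k φ) :=
        (hφ (k + 1)).differentiable_iteratedDeriv k (by exact_mod_cast Nat.lt_succ_self k)
      have := Convex.norm_image_sub_le_of_norm_deriv_le (f := iteratedDeriv k φ) (C := M)
        (s := Set.univ) (x := x) (y := y) (fun z _ => hdiff z) (fun z _ => by
          rw [← iteratedDeriv_succ]; exact hφM (k + 1) le_rfl z) convex_univ trivial trivial
      rwa [Real.norm_eq_abs, Real.norm_eq_abs, hxy,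
        abs_of_pos (show 0 < δ / h by positivity)] at this
    have hbd : |iteratedDeriv k φ y - iteratedDeriv k φ x| ≤ 2 * M :=
      (abs_sub _ _).trans (by linarith [hφM k (by omega) y, hφM k (by omega) x])
    -- Interpolation: `min (M x) (2 M) ≤ 2 M x^(β - k)` with `x = δ / h` and `0 < β - k ≤ 1`. This
    -- is the source of `2 * M` in the amplitude.
    have hmain : |iteratedDeriv k φ y - iteratedDeriv k φ x| ≤ 2 * M * (δ / h) ^ (β - k) := by
      rcases le_total (δ / h) 1 with hc | hc
      · have := Real.rpow_le_rpow_of_exponent_ge (by positivity : 0 < δ / h) hc hβk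
        rw [Real.rpow_one] at this
        have h0 : 0 ≤ δ / h := by positivity
        nlinarith
      · have := Real.one_le_rpow hc (by linarith : 0 ≤ β - k)
        nlinarith
    calc L / (2 * M) * h ^ (β - k) * |iteratedDeriv k φ y - iteratedDeriv k φ x|
        ≤ L / (2 * M) * h ^ (β - k) * (2 * M * (δ / h) ^ (β - k)) := by gcongr
      _ = L * δ ^ (β - k) := by
        rw [Real.div_rpow hδ.le hh.le]
        have : h ^ (β - k) ≠ 0 := by positivity
        field_simp

theorem zero_mem_holderClass {β L : ℝ} (hL : 0 < L) :
    (fun _ => 0) ∈ holderClass β L := by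
  refine ⟨contDiff_const, fun m _ u => ?_, fun u h hh => ?_⟩
  · rw [iteratedDeriv_const]
    split_ifs <;> simpa using hL.le
  · simp only [iteratedDeriv_const, ite_self, sub_self, abs_zero]
    positivity

/-! ### Second moment of the mixture and the nonasymptotic bound. -/

/-- Uses `e^x ≤ 1 + x e^x`. The a priori bound `c` is spent only inside the exponential, so the
result stays linear in `s` and can be integrated against the prior. -/
theorem one_add_mul_pow_le {n : ℕ} {a c : ℝ} (ha : 0 ≤ a) (hc : 0 ≤ c) {s : ℝ≥0∞}
    (hs : s ≤ ENNReal.ofReal c) :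
    (1 + ENNReal.ofReal a * s) ^ n
      ≤ 1 + ENNReal.ofReal (n * a * Real.exp (n * a * c)) * s := by
  lift s to NNReal using ne_top_of_le_ne_top ENNReal.ofReal_ne_top hs
  have hs' : (s : ℝ) ≤ c := by
    rw [← ENNReal.ofReal_coe_nnreal] at hs
    exact (ENNReal.ofReal_le_ofReal_iff hc).1 hs
  have hs0 : (0 : ℝ) ≤ s := s.2
  rw [← ENNReal.ofReal_coe_nnreal, ← ENNReal.ofReal_mul ha, ← ENNReal.ofReal_one,
    ← ENNReal.ofReal_add zero_le_one (by positivity), ← ENNReal.ofReal_pow (by positivity),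
    ← ENNReal.ofReal_mul (by positivity), ← ENNReal.ofReal_add zero_le_one (by positivity)]
  refine ENNReal.ofReal_le_ofReal ?_
  have hexp : ∀ x : ℝ, Real.exp x ≤ 1 + x * Real.exp x := by
    intro x
    have h1 := Real.add_one_le_exp (-x)
    have h2 := mul_le_mul_of_nonneg_right h1 (Real.exp_pos x).le
    rw [← Real.exp_add, neg_add_cancel, Real.exp_zero] at h2
    linarith
  calc (1 + a * s) ^ n ≤ Real.exp (a * s) ^ n := by
        gcongr
        linarith [Real.add_one_le_exp (a * s)]
    _ = Real.exp (n * a * s) := by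
        rw [← Real.exp_nat_mul]
        congr 1
        ring
    _ ≤ 1 + n * a * s * Real.exp (n * a * s) := hexp _
    _ ≤ 1 + n * a * s * Real.exp (n * a * c) := by gcongr
    _ = 1 + n * a * Real.exp (n * a * c) * s := by ring

theorem measurable_uncurry_likelihoodRatio {W : Type*} [MeasurableSpace W] (hp : Measurable p)
    {F : W → EuclideanSpace ℝ (Fin d) → ℝ} (hF : Measurable (Function.uncurry F)) (n : ℕ) :
    Measurable (Function.uncurry fun w (data : Fin n → EuclideanSpace ℝ (Fin d) × ℝ) =>
      ∏ i, likelihoodRatio p (F w) (data i)) := by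
  have h : ∀ i : Fin n, Measurable
      fun z : W × (Fin n → EuclideanSpace ℝ (Fin d) × ℝ) => F z.1 (z.2 i).1 := fun i =>
    hF.comp (f := fun z : W × (Fin n → EuclideanSpace ℝ (Fin d) × ℝ) => (z.1, (z.2 i).1))
      (by fun_prop)
  refine Finset.measurable_prod _ fun i _ => ?_
  have := h i
  unfold likelihoodRatio
  fun_prop

/-- The second moment of the mixture likelihood ratio, when the alternatives are bumps of height
`A` supported in slabs that overlap little on average. -/
theorem mixture_second_moment_le {W : Type*} [MeasurableSpace W] {q Q A C h : ℝ} {n : ℕ}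
    (hQ : 0 < Q) (hA : 0 ≤ A) (hAq : A ≤ q) (hC : 0 < C) (hh : 0 < h)
    (hg : IsProbDensity g) (hp : IsProbDensity p) (hnoise : NoiseCondition q Q p)
    {F : W → EuclideanSpace ℝ (Fin d) → ℝ} (hF : Measurable (Function.uncurry F))
    {S : W → Set (EuclideanSpace ℝ (Fin d))} (hS : ∀ w, MeasurableSet (S w))
    (hFS : ∀ w x, |F w x| ≤ (S w).indicator (fun _ => A) x)
    {ν : Measure W} (hν : ν Set.univ ≤ 1)
    (h1 : ∀ᵐ w ∂ν, volume.withDensity (fun x => ENNReal.ofReal (g x)) (S w)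
      ≤ ENNReal.ofReal (C * h))
    (h2 : ∫⁻ w, ∫⁻ w', volume.withDensity (fun x => ENNReal.ofReal (g x))
      (S w ∩ S w') ∂ν ∂ν ≤ ENNReal.ofReal (C * h ^ (3 / 2 : ℝ)))
    (hsmall : n * (Q * A ^ 2) * Real.exp (n * (Q * A ^ 2) * (C * h)) * (C * h ^ (3 / 2 : ℝ)) ≤ 1) :
    ∫⁻ w, ∫⁻ w', ∫⁻ data, (∏ i, likelihoodRatio p (F w) (data i)) *
      (∏ i, likelihoodRatio p (F w') (data i)) ∂sampleLaw n g p (fun _ => 0) ∂ν ∂ν ≤ 2 := by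
  set P := (volume : Measure (EuclideanSpace ℝ (Fin d))).withDensity
    fun x => ENNReal.ofReal (g x) with hP
  have hPprob : IsProbabilityMeasure P := hg.isProbabilityMeasure
  have hFm : ∀ w, Measurable (F w) := fun w => hF.comp measurable_prodMk_left
  have hFA : ∀ w x, |F w x| ≤ A := fun w x =>
    (hFS w x).trans (Set.indicator_le_self' (fun _ _ => hA) x)
  have hFq : ∀ w x, |F w x| ≤ q := fun w x => (hFA w x).trans hAq
  have hQA : 0 ≤ Q * A ^ 2 := by positivity
  have := isProbabilityMeasure_obsLaw hg hp (F := fun _ => 0) measurable_const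
  have hone : ∀ w w', ∫⁻ z, likelihoodRatio p (F w) z * likelihoodRatio p (F w') z
      ∂obsLaw g p (fun _ => 0) ≤ 1 + ENNReal.ofReal (Q * A ^ 2) * P (S w ∩ S w') := by
    intro w w'
    refine (lintegral_likelihoodRatio_mul_le hg hp hnoise (hFm w) (hFm w') (hFq w)
      (hFq w')).trans ?_
    have hSS := (hS w).inter (hS w')
    calc ∫⁻ x, ENNReal.ofReal (g x) * ENNReal.ofReal (1 + Q * |F w x * F w' x|)
        ≤ ∫⁻ x, ENNReal.ofReal (g x) *
            (1 + (S w ∩ S w').indicator (fun _ => ENNReal.ofReal (Q * A ^ 2)) x) := by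
          refine lintegral_mono fun x => ?_
          gcongr
          rw [ENNReal.ofReal_add zero_le_one (by positivity), ENNReal.ofReal_one, abs_mul]
          gcongr
          by_cases hx : x ∈ S w ∩ S w'
          · rw [Set.indicator_of_mem hx, pow_two]
            exact ENNReal.ofReal_le_ofReal (mul_le_mul_of_nonneg_left
              (mul_le_mul (hFA w x) (hFA w' x) (abs_nonneg _) hA) hQ.le)
          · rw [Set.indicator_of_notMem hx]
            have : |F w x| * |F w' x| = 0 := by
              rcases not_and_or.1 hx with hx | hx
              · have := hFS w x
                rw [Set.indicator_of_notMem hx] at this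
                rw [le_antisymm this (abs_nonneg _), zero_mul]
              · have := hFS w' x
                rw [Set.indicator_of_notMem hx] at this
                rw [le_antisymm this (abs_nonneg _), mul_zero]
            rw [this, mul_zero, ENNReal.ofReal_zero]
      _ = ∫⁻ x, (1 + (S w ∩ S w').indicator (fun _ => ENNReal.ofReal (Q * A ^ 2)) x) ∂P := by
          rw [hP, lintegral_withDensity_eq_lintegral_mul _ hg.measurable.ennreal_ofReal]
          · rfl
          · exact (measurable_const.indicator hSS).const_add 1
      _ = 1 + ENNReal.ofReal (Q * A ^ 2) * P (S w ∩ S w') := by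
          rw [lintegral_add_left measurable_const, lintegral_indicator_const hSS]
          simp
  have hpair : ∀ w w', ∫⁻ data, (∏ i, likelihoodRatio p (F w) (data i)) *
      (∏ i, likelihoodRatio p (F w') (data i)) ∂sampleLaw n g p (fun _ => 0)
      ≤ (1 + ENNReal.ofReal (Q * A ^ 2) * P (S w ∩ S w')) ^ n := by
    intro w w'
    simp_rw [← Finset.prod_mul_distrib]
    rw [sampleLaw, lintegral_pi_prod _ (f := fun _ z =>
      likelihoodRatio p (F w) z * likelihoodRatio p (F w') z) fun _ =>
        (measurable_likelihoodRatio hp.measurable (hFm w)).mul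
          (measurable_likelihoodRatio hp.measurable (hFm w')),
      Finset.prod_const, Finset.card_univ, Fintype.card_fin]
    gcongr
    exact hone w w'
  set K : ℝ := n * (Q * A ^ 2) * Real.exp (n * (Q * A ^ 2) * (C * h)) with hK
  have hK0 : 0 ≤ K := by positivity
  calc _ ≤ ∫⁻ w, ∫⁻ w', (1 + ENNReal.ofReal K * P (S w ∩ S w')) ∂ν ∂ν := by
        refine lintegral_mono_ae ?_
        -- The overlap is contained in the slab of `w`, so the mass bound for that one direction
        -- controls the exponent.
        filter_upwards [h1] with w hw
        refine lintegral_mono fun w' => (hpair w w').trans ?_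
        exact one_add_mul_pow_le hQA (by positivity)
          ((measure_mono Set.inter_subset_left).trans hw)
    _ ≤ 1 + ENNReal.ofReal K * ENNReal.ofReal (C * h ^ (3 / 2 : ℝ)) := by
        have hin : ∀ w, ∫⁻ w', (1 + ENNReal.ofReal K * P (S w ∩ S w')) ∂ν
            ≤ 1 + ENNReal.ofReal K * ∫⁻ w', P (S w ∩ S w') ∂ν := by
          intro w
          rw [lintegral_add_left measurable_const, lintegral_const, one_mul,
            lintegral_const_mul' _ _ ENNReal.ofReal_ne_top]
          gcongr
        refine (lintegral_mono hin).trans ?_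
        rw [lintegral_add_left measurable_const, lintegral_const, one_mul,
          lintegral_const_mul' _ _ ENNReal.ofReal_ne_top]
        gcongr
    _ ≤ 1 + 1 := by
        rw [← ENNReal.ofReal_mul hK0]
        gcongr
        rw [ENNReal.ofReal_le_one]
        exact hsmall
    _ = 2 := one_add_one_eq_two

/-- A nonasymptotic lower bound on the minimax risk: a mixture of alternatives taking the common
value `A` at `t` cannot be told apart from the null function. -/
theorem le_minimaxRisk {W : Type*} [MeasurableSpace W] {q Q A : ℝ} {n : ℕ}
    (hA : 0 ≤ A) (hg : IsProbDensity g) (hp : IsProbDensity p) (hnoise : NoiseCondition q Q p)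
    {t : EuclideanSpace ℝ (Fin d)} {r : ℝ} (hr : 1 ≤ r)
    {𝓕 : Set (EuclideanSpace ℝ (Fin d) → ℝ)} (h0 : (fun _ => 0) ∈ 𝓕)
    {F : W → EuclideanSpace ℝ (Fin d) → ℝ} (hF : Measurable (Function.uncurry F))
    (hF𝓕 : ∀ w, F w ∈ 𝓕) (hFt : ∀ w, F w t = A) (hFq : ∀ w x, |F w x| ≤ q)
    {ν : Measure W} [IsFiniteMeasure ν] (hν : 2⁻¹ ≤ ν Set.univ)
    (h2 : ∫⁻ w, ∫⁻ w', ∫⁻ data, (∏ i, likelihoodRatio p (F w) (data i)) *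
      (∏ i, likelihoodRatio p (F w') (data i)) ∂sampleLaw n g p (fun _ => 0) ∂ν ∂ν ≤ 2) :
    ENNReal.ofReal (A / 128) ≤ minimaxRisk n g p r t 𝓕 := by
  have hFm : ∀ w, Measurable (F w) := fun w => hF.comp measurable_prodMk_left
  have hlaw : ∀ w, (sampleLaw n g p fun _ => 0).withDensity
      (fun data => ∏ i, likelihoodRatio p (F w) (data i)) = sampleLaw n g p (F w) := fun w =>
    (sampleLaw_eq_withDensity n hg hp hnoise (hFm w) (hFq w)).symm
  have := isProbabilityMeasure_sampleLaw n hg hp (F := fun _ => 0) measurable_const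
  have hA128 : ENNReal.ofReal (A / 128) = ENNReal.ofReal (A / 2) * 64⁻¹ := by
    rw [← ENNReal.ofReal_ofNat, ← ENNReal.ofReal_inv_of_pos (by norm_num),
      ← ENNReal.ofReal_mul (by positivity)]
    congr 1
    ring
  refine le_iInf₂ fun Fhat hFhat => ?_
  -- The test rejects the null when the estimate reaches half the bump height; either kind of error
  -- forces a loss of at least `A / 2`.
  have hD : MeasurableSet {data | A / 2 ≤ |Fhat data t|} :=
    measurableSet_le measurable_const (hFhat t).abs
  have h64 : (64⁻¹ : ℝ≥0∞) ≤ 1 := ENNReal.inv_le_one.2 (by norm_num)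
  rw [hA128]
  rcases mixture_test_lower_bound (sampleLaw n g p fun _ => 0) ν
    (measurable_uncurry_likelihoodRatio hp.measurable hF n)
    (fun w => by rw [hlaw]; exact isProbabilityMeasure_sampleLaw n hg hp (hFm w)) hν h2 hD
    with hcase | ⟨w, hcase⟩
  · refine le_trans ?_ (le_iSup₂ (f := fun F _ => pointwiseRisk g p r t Fhat F) _ h0)
    exact le_pointwiseRisk g p hr t Fhat hFhat _ h64 (by simpa using hcase)
  · refine le_trans ?_ (le_iSup₂ (f := fun F _ => pointwiseRisk g p r t Fhat F) _ (hF𝓕 w))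
    rw [hlaw] at hcase
    refine le_pointwiseRisk g p hr t Fhat hFhat _ h64 (hcase.trans (measure_mono ?_))
    intro data hdata
    have hlt : |Fhat data t| < A / 2 := not_le.1 hdata
    change A / 2 ≤ |Fhat data t - F w t|
    rw [hFt, abs_sub_comm]
    have := abs_sub_abs_le_abs_sub A (Fhat data t)
    rw [abs_of_nonneg hA] at this
    linarith

/-! ### Bandwidth asymptotics. -/

/-- The bandwidth balancing the size of the alternatives against the number of directions. -/
noncomputable def bandwidth (b β L : ℝ) (n : ℕ) : ℝ :=
  (b * L ^ (-2 : ℝ) * ((n : ℝ)⁻¹ * Real.log n)) ^ (1 / (2 * β + 1))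

theorem mul_bandwidth_rpow {b β L : ℝ} (hb : 0 < b) (hβ : 0 < β) (hL : 0 < L) (n : ℕ) :
    L * bandwidth b β L n ^ β = b ^ (β / (2 * β + 1)) * rate n β L := by
  have hlam : 0 ≤ (n : ℝ)⁻¹ * Real.log n :=
    mul_nonneg (by positivity) (Real.log_natCast_nonneg n)
  have hL2 : 0 < L ^ (-2 : ℝ) := by positivity
  rw [bandwidth, rate, ← Real.rpow_mul (by positivity), one_div_mul_eq_div,
    Real.mul_rpow (by positivity) hlam, Real.mul_rpow hb.le hL2.le, ← Real.rpow_mul hL.le]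
  have : L * L ^ (-2 * (β / (2 * β + 1))) = L ^ (1 / (2 * β + 1)) := by
    rw [← Real.rpow_one_add' hL.le]
    · congr 1
      field_simp
      ring
    · have : 1 + -2 * (β / (2 * β + 1)) = 1 / (2 * β + 1) := by
        field_simp
        ring
      rw [this]
      positivity
  rw [← this]
  ring

/-- The equation that `bandwidth` is designed to solve: the signal energy on one slab is a multiple
of `log n`, with `L` cancelling. -/
theorem mul_bandwidth_energy {b β L : ℝ} (hb : 0 < b) (hβ : 0 < β) (hL : 0 < L) {n : ℕ}
    (hn : 0 < n) :
    n * (L * bandwidth b β L n ^ β) ^ 2 * bandwidth b β L n = b * Real.log n := by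
  have hlam : 0 ≤ (n : ℝ)⁻¹ * Real.log n :=
    mul_nonneg (by positivity) (Real.log_natCast_nonneg n)
  have hh : 0 ≤ bandwidth b β L n := by
    unfold bandwidth
    positivity
  have hpow : (bandwidth b β L n ^ β) ^ 2 * bandwidth b β L n
      = b * L ^ (-2 : ℝ) * ((n : ℝ)⁻¹ * Real.log n) := by
    rw [← Real.rpow_natCast, ← Real.rpow_mul hh]
    nth_rewrite 2 [← Real.rpow_one (bandwidth b β L n)]
    rw [← Real.rpow_add_of_nonneg hh (by positivity) zero_le_one, bandwidth,
      ← Real.rpow_mul (by positivity)]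
    have : 1 / (2 * β + 1) * (β * (2 : ℕ) + 1) = 1 := by
      push_cast
      field_simp
    rw [this, Real.rpow_one]
  have hL2 : L ^ 2 * L ^ (-2 : ℝ) = 1 := by
    rw [Real.rpow_neg hL.le, Real.rpow_two]
    field_simp
  have hn0 : (n : ℝ) ≠ 0 := by positivity
  calc n * (L * bandwidth b β L n ^ β) ^ 2 * bandwidth b β L n
      = n * L ^ 2 * ((bandwidth b β L n ^ β) ^ 2 * bandwidth b β L n) := by ring
    _ = (L ^ 2 * L ^ (-2 : ℝ)) * b * (n * (n : ℝ)⁻¹) * Real.log n := by rw [hpow]; ring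
    _ = b * Real.log n := by rw [hL2, mul_inv_cancel₀ hn0]; ring

open Filter Topology in
theorem tendsto_inv_mul_log : Tendsto (fun n : ℕ => (n : ℝ)⁻¹ * Real.log n) atTop (𝓝 0) := by
  have h := (Real.isLittleO_log_id_atTop.tendsto_div_nhds_zero).comp tendsto_natCast_atTop_atTop
  refine h.congr fun n => ?_
  simp only [Function.comp, id]
  rw [div_eq_inv_mul]

open Filter Topology in
theorem tendsto_bandwidth {b β L : ℝ} (hβ : 0 < β) :
    Tendsto (bandwidth b β L) atTop (𝓝 0) := by
  have h := (tendsto_inv_mul_log.const_mul (b * L ^ (-2 : ℝ))).rpow_const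
    (p := 1 / (2 * β + 1)) (Or.inr (by positivity))
  rwa [mul_zero, Real.zero_rpow (by positivity)] at h

open Filter Topology in
-- For this `γ`, `h^(1/2)` is a multiple of `(log n / n)^(2γ)`, so it absorbs the factor `n^γ` and
-- leaves a multiple of `(log n)^(1 + 2γ) n^(-γ)`.
theorem tendsto_overlap {b β L γ : ℝ} (hb : 0 < b) (hβ : 0 < β) (hL : 0 < L)
    (hγ : γ = 1 / (4 * (2 * β + 1))) :
    Tendsto (fun n : ℕ => γ * Real.log n * Real.exp (γ * Real.log n)
      * bandwidth b β L n ^ (1 / 2 : ℝ)) atTop (𝓝 0) := by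
  have hγ0 : 0 < γ := by rw [hγ]; positivity
  have h := ((isLittleO_log_rpow_rpow_atTop (1 + 2 * γ) hγ0).tendsto_div_nhds_zero).comp
    tendsto_natCast_atTop_atTop
  have h' := h.const_mul (γ * (b * L ^ (-2 : ℝ)) ^ (2 * γ))
  rw [mul_zero] at h'
  refine h'.congr' ?_
  filter_upwards [eventually_ge_atTop 2] with n hn
  have hn0 : (0 : ℝ) < n := by positivity
  have hlog : 0 < Real.log n := Real.log_pos (by exact_mod_cast hn)
  have hL2 : 0 < L ^ (-2 : ℝ) := by positivity
  simp only [Function.comp]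
  have hexp : Real.exp (γ * Real.log n) = (n : ℝ) ^ γ := by
    rw [Real.rpow_def_of_pos hn0, mul_comm]
  have hbw : bandwidth b β L n ^ (1 / 2 : ℝ)
      = (b * L ^ (-2 : ℝ)) ^ (2 * γ) * ((n : ℝ) ^ γ * (n : ℝ) ^ γ)⁻¹ * Real.log n ^ (2 * γ) := by
    rw [bandwidth, ← Real.rpow_mul (by positivity)]
    have : 1 / (2 * β + 1) * (1 / 2) = 2 * γ := by
      rw [hγ]
      field_simp
      norm_num
    rw [this, Real.mul_rpow (by positivity) (by positivity),
      Real.mul_rpow (by positivity) hlog.le, Real.inv_rpow hn0.le, ← Real.rpow_add hn0, ← two_mul]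
    ring
  rw [hexp, hbw, Real.rpow_add hlog, Real.rpow_one]
  have : (n : ℝ) ^ γ ≠ 0 := by positivity
  field_simp

end SingleIndex

/-! ### Choice of constants and conclusion. -/

theorem theorem4 (d : ℕ) (hd : 2 ≤ d) (β : ℝ) (hβ : 0 < β)
    (q Q G ϖ : ℝ) (hq : 0 < q) (hQ : 0 < Q) (hG : 0 < G) (hϖ : 1 < ϖ) :
    ∃ κ : ℝ, 0 < κ ∧
      ∀ (p : ℝ → ℝ) (g : EuclideanSpace ℝ (Fin d) → ℝ),
        SingleIndex.IsProbDensity p → SingleIndex.IsCentered p →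
        SingleIndex.IsProbDensity g →
        SingleIndex.NoiseCondition q Q p → SingleIndex.DesignCondition G ϖ g →
        ∀ t : EuclideanSpace ℝ (Fin d), (∀ i, t i ∈ Set.Icc (-(1 / 2) : ℝ) (1 / 2)) →
        ∀ r : ℝ, 1 ≤ r → ∀ L : ℝ, 0 < L →
          ∃ n₀ : ℕ, ∀ n : ℕ, n₀ ≤ n →
            ENNReal.ofReal (κ * SingleIndex.rate n β L) ≤
              SingleIndex.minimaxRisk n g p r t (SingleIndex.singleIndexClass d β L) := by
  open SingleIndex Filter in
  obtain ⟨θ, C, hθ, hθ1, hC, hprior⟩ := exists_localized_prior hd hG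
  obtain ⟨φ, M, hM, hφ, hφ0, hφnn, hφ1, hφsupp, hφM⟩ := exists_bump (holderOrder β + 1)
  have hM0 : 0 < M := by linarith
  obtain ⟨γ, hγ⟩ : ∃ γ : ℝ, γ = 1 / (4 * (2 * β + 1)) := ⟨_, rfl⟩
  have hγ0 : 0 < γ := by rw [hγ]; positivity
  -- Chosen so that `n Q A² C h = γ log n` exactly when `A = L h^β / (2M)`; it does not involve `L`.
  set b : ℝ := 4 * M ^ 2 * γ / (Q * C) with hb
  have hb0 : 0 < b := by positivity
  -- `256 M` is the `128` of `le_minimaxRisk` times the `2M` in the amplitude.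
  refine ⟨b ^ (β / (2 * β + 1)) / (256 * M), by positivity, ?_⟩
  intro p g hp _ hg hnoise hdesign t _ r hr L hL
  have hgG : ∀ x, g x ≤ G := fun x => (hdesign x).trans
    (mul_le_of_le_one_left hG.le (inv_le_one_of_one_le₀ (by
      linarith [Real.rpow_nonneg (norm_nonneg x) ϖ])))
  have hbw := tendsto_bandwidth (b := b) (L := L) hβ
  have hheight : Tendsto (fun n => L * bandwidth b β L n ^ β / (2 * M)) atTop (nhds 0) := by
    have := ((hbw.rpow_const (p := β) (Or.inr hβ.le)).const_mul L).div_const (2 * M)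
    rwa [Real.zero_rpow hβ.ne', mul_zero, zero_div] at this
  have hev := ((eventually_ge_atTop 2).and ((hbw.eventually_le_const one_pos).and
    ((hheight.eventually_le_const hq).and
      ((tendsto_overlap hb0 hβ hL hγ).eventually_le_const one_pos))))
  obtain ⟨n₀, hn₀⟩ := eventually_atTop.1 hev
  refine ⟨n₀, fun n hn => ?_⟩
  obtain ⟨hn2, hh1, hAq, hover⟩ := hn₀ n hn
  have hlog : 0 < Real.log n := Real.log_pos (by exact_mod_cast hn2)
  have hscale := mul_bandwidth_rpow hb0 hβ hL n
  have henergy := mul_bandwidth_energy hb0 hβ hL (n := n) (by omega)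
  have hh : 0 < bandwidth b β L n := by
    unfold bandwidth
    positivity
  set h := bandwidth b β L n with hhdef
  set A := L * h ^ β / (2 * M) with hA
  have hA0 : 0 ≤ A := by positivity
  have hK : n * (Q * A ^ 2) * (C * h) = γ * Real.log n := by
    calc n * (Q * A ^ 2) * (C * h)
        = Q * C / (4 * M ^ 2) * (n * (L * h ^ β) ^ 2 * h) := by rw [hA]; ring
      _ = γ * Real.log n := by
        rw [henergy, hb]
        field_simp
  have hsmall : n * (Q * A ^ 2) * Real.exp (n * (Q * A ^ 2) * (C * h)) *
      (C * h ^ (3 / 2 : ℝ)) ≤ 1 := by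
    have h32 : h ^ (3 / 2 : ℝ) = h * h ^ (1 / 2 : ℝ) := by
      rw [← Real.rpow_one_add' hh.le (by norm_num)]
      norm_num
    -- Writing `h^(3/2) = h * h^(1/2)` completes the prefactor to `γ log n` and leaves exactly the
    -- vanishing quantity of `tendsto_overlap`.
    calc n * (Q * A ^ 2) * Real.exp (n * (Q * A ^ 2) * (C * h)) * (C * h ^ (3 / 2 : ℝ))
        = n * (Q * A ^ 2) * (C * h) * Real.exp (n * (Q * A ^ 2) * (C * h)) * h ^ (1 / 2 : ℝ) := by
          rw [h32]
          ring
      _ ≤ 1 := by rw [hK]; exact hover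
  obtain ⟨ν, hν, hν1, hslab, hpair⟩ := hprior g hg hgG t h hh
  have hνfin : IsFiniteMeasure ν := ⟨hν1.trans_lt ENNReal.one_lt_top⟩
  let F : EuclideanSpace ℝ (Fin d) → EuclideanSpace ℝ (Fin d) → ℝ :=
    fun w x => A * φ (h⁻¹ * (inner ℝ x (θ w) - inner ℝ t (θ w)))
  have hφm : Measurable φ := (hφ 0).continuous.measurable
  have hFm : Measurable (Function.uncurry F) := by
    simp only [F, Function.uncurry_def]
    fun_prop
  have hFS : ∀ w x, |F w x| ≤ (slab t (θ w) h).indicator (fun _ => A) x := by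
    intro w x
    by_cases hx : x ∈ slab t (θ w) h
    · rw [Set.indicator_of_mem hx, abs_of_nonneg (mul_nonneg hA0 (hφnn _))]
      exact mul_le_of_le_one_right hA0 (hφ1 _)
    · rw [Set.indicator_of_notMem hx]
      have hx' : h < |inner ℝ x (θ w) - inner ℝ t (θ w)| := by
        rw [← inner_sub_left]
        exact not_le.1 hx
      have : φ (h⁻¹ * (inner ℝ x (θ w) - inner ℝ t (θ w))) = 0 := by
        refine hφsupp _ ?_
        rw [abs_mul, abs_of_pos (inv_pos.2 hh), inv_mul_eq_div, one_lt_div hh]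
        exact hx'
      simp [F, this]
  have hFq : ∀ w x, |F w x| ≤ q := fun w x =>
    (hFS w x).trans ((Set.indicator_le_self' (fun _ _ => hA0) x).trans hAq)
  have hFmem : ∀ w, F w ∈ singleIndexClass d β L := fun w =>
    ⟨_, rescaled_bump_mem_holderClass hβ hL hh hh1 hM hφ hφM (inner ℝ t (θ w)), θ w, hθ1 w,
      fun _ => rfl⟩
  have hFt : ∀ w, F w t = A := fun w => by simp [F, hφ0]
  have h0 : (fun _ => 0) ∈ singleIndexClass d β L :=
    ⟨_, zero_mem_holderClass hL, θ 0, hθ1 0, fun _ => rfl⟩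
  have h2 := mixture_second_moment_le hQ hA0 hAq hC hh hg hp hnoise hFm
    (fun w => measurableSet_slab t (θ w) h) hFS hν1 hslab hpair hsmall
  refine le_trans (ENNReal.ofReal_le_ofReal (le_of_eq ?_))
    (le_minimaxRisk hA0 hg hp hnoise hr h0 hFm hFmem hFt hFq hν h2)
  rw [hA, hscale]
  ring
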